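/- Let $n\ge 0$. For $x\in\mathbb{R}^n$ let $N(x)=\{z\in\mathbb{Z}^n : |x_i-z_i|<1 \ (i=1,\dots,n)\}$. A set $S\subseteq\mathbb{Z}^n$ is called integrally convex if it is nonempty and the union $\bigcup_{x\in\mathbb{R}^n}\operatorname{conv}(S\cap N(x))$ is convex, where $\operatorname{conv}$ denotes the convex hull in $\mathbb{R}^n$. A polytope is the convex hull of a finite set of points of $\mathbb{R}^n$. A polyhedral cone is a nonempty set of the form $\{x\in\mathbb{R}^n : Ax\le b\}$, for a real matrix $A$ and a real vector $b$, that is closed under multiplication by nonnegative scalars. Let $S\subseteq\mathbb{Z}^n$ be an integrally convex set. Then there exist a polytope $Q\subseteq\mathbb{R}^n$ and a polyhedral cone $C\subseteq\mathbb{R}^n$ such that $\operatorname{conv} S = Q + C$ (Minkowski sum) and both $Q\cap\mathbb{Z}^n$ and $C\cap\mathbb{Z}^n$ are integrally convex. -/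

import Mathlib

open scoped Pointwise Matrix

namespace IntConvex

/-- The inclusion of the integer lattice `ℤⁿ` into `ℝⁿ`. -/
def toReal {n : ℕ} (z : Fin n → ℤ) : Fin n → ℝ := fun i => (z i : ℝ)

/-- The integral neighborhood `N(x)` of a real vector `x`: the integer vectors `z` with
`|x i - z i| < 1` for every coordinate `i`. -/
def integralNeighborhood {n : ℕ} (x : Fin n → ℝ) : Set (Fin n → ℤ) :=
  {z | ∀ i, |x i - (z i : ℝ)| < 1}

/-- The convex hull in `ℝⁿ` of a set of integer vectors. -/
def hull {n : ℕ} (S : Set (Fin n → ℤ)) : Set (Fin n → ℝ) :=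
  convexHull ℝ (toReal '' S)

/-- The set `X ∩ ℤⁿ` of the integer vectors that belong to a set `X` of real vectors. -/
def integerPoints {n : ℕ} (X : Set (Fin n → ℝ)) : Set (Fin n → ℤ) :=
  {z | toReal z ∈ X}

/-- A set of integer vectors is integrally convex if it is nonempty and the union, over all
real vectors `x`, of its local convex hulls (the convex hulls of `S ∩ N(x)`) is convex. -/
def IsIntegrallyConvex {n : ℕ} (S : Set (Fin n → ℤ)) : Prop :=
  S.Nonempty ∧ Convex ℝ (⋃ x : Fin n → ℝ, hull (S ∩ integralNeighborhood x))

/-- A polyhedron: a nonempty set described by finitely many linear inequalities `A x ≤ b`. -/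
def IsPolyhedron {n : ℕ} (P : Set (Fin n → ℝ)) : Prop :=
  P.Nonempty ∧
    ∃ (m : ℕ) (A : Matrix (Fin m) (Fin n) ℝ) (b : Fin m → ℝ), P = {x | A *ᵥ x ≤ b}

/-- A polytope: the convex hull of finitely many points. -/
def IsPolytope {n : ℕ} (Q : Set (Fin n → ℝ)) : Prop :=
  ∃ F : Set (Fin n → ℝ), F.Finite ∧ Q = convexHull ℝ F

/-- A cone: a set closed under multiplication by nonnegative scalars. -/
def IsCone {n : ℕ} (C : Set (Fin n → ℝ)) : Prop :=
  ∀ d ∈ C, ∀ t : ℝ, 0 ≤ t → t • d ∈ C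

/-- A polyhedral cone: a polyhedron that is a cone. -/
def IsPolyhedralCone {n : ℕ} (C : Set (Fin n → ℝ)) : Prop :=
  IsPolyhedron C ∧ IsCone C

end IntConvex

namespace IntConvex

variable {n : ℕ} {S : Set (Fin n → ℤ)}

/-! Take `Q` to be `hull S` cut by a large integer box, and `C` the recession cone of `hull S`.
Integral convexity is used locally: every `x ∈ hull S` lies in `hull (S ∩ integralNeighborhood x)`
(`mem_hull_neighborhood`). Points of a box have their neighborhoods in the box, so every nonempty
cut is a polytope with integrally convex lattice points.

Polyhedrality (`exists_hull_eq`): the tangent cone at `p ∈ S` is generated by steps with entries in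
{-1, 0, 1}, so only finitely many cones occur and finitely many integer normals suffice. Dickson's
lemma on the slack vectors gives a finite part of `S` dominating the rest modulo `C`; a box
containing it yields the decomposition.

For `C`, it suffices that `C` meets each unit cube in a polytope with integral vertices
(`extremePoints_polarCone_subset`). Such a vertex `v` is translated by a suitable `p ∈ S` into `hull
S`, where the local representation of `p + v` forces `v` to be integral. -/

/-! ### Convex hulls and integral neighborhoods -/

theorem hull_mono {S T : Set (Fin n → ℤ)} (h : S ⊆ T) : hull S ⊆ hull T :=
  convexHull_mono (Set.image_mono h)

theorem convex_hull (S : Set (Fin n → ℤ)) : Convex ℝ (hull S) := convex_convexHull ℝ _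

theorem mem_hull {z : Fin n → ℤ} (hz : z ∈ S) : toReal z ∈ hull S :=
  subset_convexHull ℝ _ (Set.mem_image_of_mem _ hz)

theorem toReal_dotProduct (a z : Fin n → ℤ) : toReal a ⬝ᵥ toReal z = ((a ⬝ᵥ z : ℤ) : ℝ) := by
  simp [toReal, dotProduct]

theorem convex_dotProduct_le (a : Fin n → ℝ) (m : ℝ) : Convex ℝ {x : Fin n → ℝ | a ⬝ᵥ x ≤ m} := by
  intro x hx y hy s t hs ht hst
  simp only [Set.mem_ofPred_eq, dotProduct_add, dotProduct_smul, smul_eq_mul] at *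
  nlinarith [mul_le_mul_of_nonneg_left hx hs, mul_le_mul_of_nonneg_left hy ht, congrArg (· * m) hst]

/-- A point in the convex hull of `S` that maximizes a linear functional lies in the convex hull
of the maximizers in `S`. -/
theorem mem_hull_maximizers {a : Fin n → ℝ} {m : ℝ} (hS : ∀ z ∈ S, a ⬝ᵥ toReal z ≤ m)
    {x : Fin n → ℝ} (hx : x ∈ hull S) (hm : a ⬝ᵥ x = m) :
    x ∈ hull {z ∈ S | a ⬝ᵥ toReal z = m} := by
  set M := hull {z ∈ S | a ⬝ᵥ toReal z = m}
  have key : hull S ⊆ {y | a ⬝ᵥ y < m ∨ (a ⬝ᵥ y = m ∧ y ∈ M)} := by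
    refine convexHull_min ?_ ?_
    · rintro _ ⟨z, hz, rfl⟩
      rcases (hS z hz).lt_or_eq with h | h
      · exact Or.inl h
      · exact Or.inr ⟨h, mem_hull ⟨hz, h⟩⟩
    · refine convex_iff_forall_pos.2 fun y hy z hz s t hs ht hst => ?_
      simp only [Set.mem_ofPred_eq, dotProduct_add, dotProduct_smul, smul_eq_mul] at *
      have hmm := congrArg (· * m) hst
      simp only [add_mul, one_mul] at hmm
      rcases hy with hy | ⟨hy, hyM⟩ <;> rcases hz with hz | ⟨hz, hzM⟩
      · left; nlinarith [mul_lt_mul_of_pos_left hy hs, mul_lt_mul_of_pos_left hz ht]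
      · left; nlinarith [mul_lt_mul_of_pos_left hy hs]
      · left; nlinarith [mul_lt_mul_of_pos_left hz ht]
      · right
        exact ⟨by rw [hy, hz, hmm], convex_hull _ hyM hzM hs.le ht.le hst⟩
  rcases key hx with h | h
  · exact absurd hm h.ne
  · exact h.2

/-- Points of one neighborhood differ by at most 1 in each coordinate. In a convex combination with
positive weights, the term of `u j` contributes 0 to the distance from `x` to `u j`, so that
distance is strictly below 1. -/
theorem hull_inter_neighborhood {x y : Fin n → ℝ} (hx : x ∈ hull (S ∩ integralNeighborhood y)) :
    x ∈ hull (S ∩ integralNeighborhood x) := by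
  obtain ⟨ι, _, z, w, hz, -, hw, hw1, hsum⟩ := eq_pos_convex_span_of_mem_convexHull hx
  have hz' : ∀ j, ∃ u, u ∈ S ∩ integralNeighborhood y ∧ toReal u = z j :=
    fun j => hz (Set.mem_range_self j)
  choose u hu huz using hz'
  rw [← hsum]
  refine (convex_hull _).sum_mem (fun j _ => (hw j).le) hw1 fun j _ => ?_
  rw [hsum, ← huz j]
  refine mem_hull ⟨(hu j).1, fun i => ?_⟩
  have hxi : x i - u j i = ∑ l, w l * ((u l i : ℝ) - u j i) := by
    simp only [mul_sub, Finset.sum_sub_distrib, ← Finset.sum_mul, hw1, one_mul]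
    rw [← hsum]
    simp [Finset.sum_apply, ← huz, toReal]
  have hle : ∀ l, |(u l i : ℝ) - u j i| ≤ 1 := by
    intro l
    have h1 := (hu l).2 i
    have h2 := (hu j).2 i
    rw [abs_lt] at h1 h2
    have h3 : u l i - u j i < 2 := by
      have : ((u l i - u j i : ℤ) : ℝ) < 2 := by push_cast; linarith
      exact_mod_cast this
    have h4 : -2 < u l i - u j i := by
      have : (-2 : ℝ) < ((u l i - u j i : ℤ) : ℝ) := by push_cast; linarith
      exact_mod_cast this
    have h5 : |u l i - u j i| ≤ 1 := abs_le.2 ⟨by omega, by omega⟩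
    exact_mod_cast h5
  rw [hxi]
  calc |∑ l, w l * ((u l i : ℝ) - u j i)|
      ≤ ∑ l, w l * |(u l i : ℝ) - u j i| := by
        refine (Finset.abs_sum_le_sum_abs _ _).trans (le_of_eq ?_)
        exact Finset.sum_congr rfl fun l _ => by rw [abs_mul, abs_of_pos (hw l)]
    _ < ∑ l, w l := by
        refine Finset.sum_lt_sum (fun l _ => mul_le_of_le_one_right (hw l).le (hle l))
          ⟨j, Finset.mem_univ _, ?_⟩
        simpa using hw j
    _ = 1 := hw1

theorem IsIntegrallyConvex.mem_hull_neighborhood (hS : IsIntegrallyConvex S) {x : Fin n → ℝ}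
    (hx : x ∈ hull S) : x ∈ hull (S ∩ integralNeighborhood x) := by
  have h : hull S ⊆ ⋃ x : Fin n → ℝ, hull (S ∩ integralNeighborhood x) := by
    refine convexHull_min ?_ hS.2
    rintro _ ⟨z, hz, rfl⟩
    exact Set.mem_iUnion.2 ⟨toReal z, mem_hull ⟨hz, fun i => by simp [toReal]⟩⟩
  obtain ⟨y, hy⟩ := Set.mem_iUnion.1 (h hx)
  exact hull_inter_neighborhood hy

theorem hull_integerPoints_subset {X : Set (Fin n → ℝ)} (hX : Convex ℝ X) :
    hull (integerPoints X) ⊆ X :=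
  convexHull_min (by rintro _ ⟨z, hz, rfl⟩; exact hz) hX

theorem isIntegrallyConvex_integerPoints {X : Set (Fin n → ℝ)} (hX : Convex ℝ X)
    (hne : (integerPoints X).Nonempty)
    (h : ∀ x ∈ X, ∃ y, x ∈ hull (integerPoints X ∩ integralNeighborhood y)) :
    IsIntegrallyConvex (integerPoints X) := by
  refine ⟨hne, ?_⟩
  convert hX
  refine Set.Subset.antisymm (Set.iUnion_subset fun y => ?_) fun x hx => Set.mem_iUnion.2 (h x hx)
  exact (hull_mono Set.inter_subset_left).trans (hull_integerPoints_subset hX)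

/-! ### Cutting by integer boxes -/

/-- The cube `[-R, R]ⁿ`. -/
def box (n : ℕ) (R : ℕ) : Set (Fin n → ℝ) := Set.Icc (fun _ => -(R : ℝ)) (fun _ => (R : ℝ))

theorem mem_box {R : ℕ} {x : Fin n → ℝ} : x ∈ box n R ↔ ∀ i, |x i| ≤ R := by
  simp [box, Set.mem_Icc, Pi.le_def, abs_le, forall_and]

theorem convex_box (R : ℕ) : Convex ℝ (box n R) := convex_Icc _ _

theorem exists_mem_box (x : Fin n → ℝ) : ∃ R₀ : ℕ, ∀ R ≥ R₀, x ∈ box n R := by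
  obtain ⟨R₀, h⟩ := exists_nat_ge (∑ i, |x i|)
  refine ⟨R₀, fun R hR => mem_box.2 fun i => ?_⟩
  refine (Finset.single_le_sum (f := fun i => |x i|) (fun i _ => abs_nonneg _)
    (Finset.mem_univ i)).trans (h.trans ?_)
  exact_mod_cast hR

theorem finite_integerPoints_box (R : ℕ) : (integerPoints (box n R)).Finite := by
  refine (Set.finite_Icc (fun _ : Fin n => -(R : ℤ)) (fun _ => (R : ℤ))).subset fun z hz => ?_
  have hz' := mem_box.1 hz
  simp only [toReal] at hz'
  have h : ∀ i, |z i| ≤ (R : ℤ) := fun i => by exact_mod_cast hz' i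
  exact ⟨fun i => (abs_le.1 (h i)).1, fun i => (abs_le.1 (h i)).2⟩

theorem integralNeighborhood_subset_box {R : ℕ} {x : Fin n → ℝ} (hx : x ∈ box n R) :
    integralNeighborhood x ⊆ integerPoints (box n R) := by
  intro z hz
  refine mem_box.2 fun i => ?_
  have h1 := abs_le.1 (mem_box.1 hx i)
  have h2 := abs_lt.1 (hz i)
  have h3 : z i < R + 1 := by
    have : (z i : ℝ) < ((R + 1 : ℤ) : ℝ) := by push_cast; linarith
    exact_mod_cast this
  have h4 : -(R + 1 : ℤ) < z i := by
    have : ((-(R + 1) : ℤ) : ℝ) < z i := by push_cast; linarith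
    exact_mod_cast this
  have h5 : |z i| ≤ (R : ℤ) := abs_le.2 ⟨by omega, by omega⟩
  simp only [toReal]
  exact_mod_cast h5

theorem IsIntegrallyConvex.hull_inter_box (hS : IsIntegrallyConvex S) (R : ℕ) :
    hull S ∩ box n R = hull (S ∩ integerPoints (box n R)) := by
  refine Set.Subset.antisymm ?_ (Set.subset_inter (hull_mono Set.inter_subset_left) ?_)
  · rintro x ⟨hx, hxR⟩
    exact hull_mono (Set.inter_subset_inter_right _ (integralNeighborhood_subset_box hxR))
      (hS.mem_hull_neighborhood hx)
  · exact (hull_mono Set.inter_subset_right).trans (hull_integerPoints_subset (convex_box R))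

theorem IsIntegrallyConvex.isClosed_hull_inter_box (hS : IsIntegrallyConvex S) (R : ℕ) :
    IsClosed (hull S ∩ box n R) := by
  rw [hS.hull_inter_box]
  exact (((finite_integerPoints_box R).inter_of_right S).image toReal).isClosed_convexHull ℝ

theorem IsIntegrallyConvex.isIntegrallyConvex_inter_box (hS : IsIntegrallyConvex S) {R : ℕ}
    (hne : (hull S ∩ box n R).Nonempty) :
    IsIntegrallyConvex (integerPoints (hull S ∩ box n R)) := by
  have hsub : S ∩ integerPoints (box n R) ⊆ integerPoints (hull S ∩ box n R) :=
    fun z hz => ⟨mem_hull hz.1, hz.2⟩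
  refine isIntegrallyConvex_integerPoints ((convex_hull S).inter (convex_box R)) ?_ ?_
  · rw [hS.hull_inter_box] at hne
    obtain ⟨_, ⟨z, hz, rfl⟩⟩ := convexHull_nonempty_iff.1 hne
    exact ⟨z, hsub hz⟩
  · rintro x ⟨hx, hxR⟩
    refine ⟨x, hull_mono ?_ (hS.mem_hull_neighborhood hx)⟩
    exact fun z hz => ⟨hsub ⟨hz.1, integralNeighborhood_subset_box hxR hz.2⟩, hz.2⟩

/-! ### Integer duality for finitely generated cones -/

/-- Fourier–Motzkin elimination of one variable, with integer coefficients. -/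
theorem exists_elimination (A : Finset (Fin n → ℤ)) (g : Fin n → ℤ) :
    ∃ A' : Finset (Fin n → ℤ), ∀ x : Fin n → ℝ,
      (∃ t : ℝ, 0 ≤ t ∧ ∀ a ∈ A, toReal a ⬝ᵥ (x - t • toReal g) ≤ 0) ↔
        ∀ a ∈ A', toReal a ⬝ᵥ x ≤ 0 := by
  classical
  let f : (Fin n → ℤ) × (Fin n → ℤ) → (Fin n → ℤ) :=
    fun q => (-(q.1 ⬝ᵥ g)) • q.2 + (q.2 ⬝ᵥ g) • q.1
  have hf : ∀ a b x, toReal (f (a, b)) ⬝ᵥ x =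
      -(toReal a ⬝ᵥ toReal g) * (toReal b ⬝ᵥ x) + (toReal b ⬝ᵥ toReal g) * (toReal a ⬝ᵥ x) := by
    intro a b x
    have : toReal (f (a, b)) =
        (-(toReal a ⬝ᵥ toReal g)) • toReal b + (toReal b ⬝ᵥ toReal g) • toReal a := by
      ext i
      simp [f, toReal_dotProduct]
      simp [toReal]
    rw [this, add_dotProduct, smul_dotProduct, smul_dotProduct]
    simp
  -- Functionals positive on `g` bound `t` from below, negative ones from above. Pairing the upper
  -- bounds with the lower bound `0 ≤ t` leaves the functional itself; pairing them with the other
  -- lower bounds gives `f`.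
  refine ⟨A.filter (fun a => a ⬝ᵥ g ≤ 0) ∪
    ((A.filter fun a => a ⬝ᵥ g < 0) ×ˢ (A.filter fun a => 0 < a ⬝ᵥ g)).image f, fun x => ?_⟩
  simp only [dotProduct_sub, dotProduct_smul, smul_eq_mul]
  constructor
  · rintro ⟨t, ht, h⟩ a ha
    rcases Finset.mem_union.1 ha with ha | ha
    · obtain ⟨haA, hag⟩ := Finset.mem_filter.1 ha
      have hag' : toReal a ⬝ᵥ toReal g ≤ 0 := by rw [toReal_dotProduct]; exact_mod_cast hag
      nlinarith [h a haA, mul_nonneg ht (neg_nonneg.2 hag')]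
    · obtain ⟨⟨a, b⟩, hab, rfl⟩ := Finset.mem_image.1 ha
      simp only [Finset.mem_product, Finset.mem_filter] at hab
      obtain ⟨⟨ha, hag⟩, hb, hbg⟩ := hab
      have hag' : toReal a ⬝ᵥ toReal g < 0 := by rw [toReal_dotProduct]; exact_mod_cast hag
      have hbg' : 0 < toReal b ⬝ᵥ toReal g := by rw [toReal_dotProduct]; exact_mod_cast hbg
      rw [hf]
      nlinarith [mul_nonneg (neg_nonneg.2 hag'.le) (neg_nonneg.2 (h b hb)),
        mul_nonneg hbg'.le (neg_nonneg.2 (h a ha))]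
  · intro h
    let T : Finset ℝ := insert 0 ((A.filter fun a => 0 < a ⬝ᵥ g).image
      fun b => (toReal b ⬝ᵥ x) / (toReal b ⬝ᵥ toReal g))
    obtain ⟨t, htT, htmax⟩ := T.exists_max_image id ⟨0, Finset.mem_insert_self _ _⟩
    simp only [id] at htmax
    refine ⟨t, htmax 0 (Finset.mem_insert_self _ _), fun a ha => ?_⟩
    rcases lt_trichotomy (a ⬝ᵥ g) 0 with hag | hag | hag
    · have hag' : toReal a ⬝ᵥ toReal g < 0 := by rw [toReal_dotProduct]; exact_mod_cast hag
      rcases Finset.mem_insert.1 htT with rfl | htT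
      · simpa using h a (Finset.mem_union_left _ (Finset.mem_filter.2 ⟨ha, hag.le⟩))
      · obtain ⟨b, hb, rfl⟩ := Finset.mem_image.1 htT
        have hbg := (Finset.mem_filter.1 hb).2
        have hbg' : 0 < toReal b ⬝ᵥ toReal g := by rw [toReal_dotProduct]; exact_mod_cast hbg
        have hab := h (f (a, b)) (Finset.mem_union_right _ (Finset.mem_image_of_mem f
          (Finset.mem_product.2 ⟨Finset.mem_filter.2 ⟨ha, hag⟩, hb⟩)))
        rw [hf] at hab
        rw [div_mul_eq_mul_div, sub_nonpos, le_div_iff₀ hbg']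
        linarith
    · have hag' : toReal a ⬝ᵥ toReal g = 0 := by rw [toReal_dotProduct]; exact_mod_cast hag
      rw [hag', mul_zero, sub_zero]
      exact h a (Finset.mem_union_left _ (Finset.mem_filter.2 ⟨ha, hag.le⟩))
    · have hag' : 0 < toReal a ⬝ᵥ toReal g := by rw [toReal_dotProduct]; exact_mod_cast hag
      rw [sub_nonpos, ← div_le_iff₀ hag']
      exact htmax _ (Finset.mem_insert_of_mem
        (Finset.mem_image_of_mem _ (Finset.mem_filter.2 ⟨ha, hag⟩)))

/-- A cone generated by finitely many integer vectors is the solution set of finitely many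
homogeneous linear inequalities with integer coefficients. -/
theorem exists_dual_description (U : Set (Fin n → ℤ)) (hU : U.Finite) :
    ∃ A : Finset (Fin n → ℤ), ∀ x : Fin n → ℝ,
      x ∈ Submodule.span NNReal (toReal '' U) ↔ ∀ a ∈ A, toReal a ⬝ᵥ x ≤ 0 := by
  classical
  induction U, hU using Set.Finite.induction_on with
  | empty =>
    -- The zero cone is cut out by the functionals `±eᵢ`.
    refine ⟨Finset.univ.image (fun i => Pi.single i 1) ∪
      Finset.univ.image (fun i => -Pi.single i 1), fun x => ?_⟩
    have h1 : ∀ i : Fin n, toReal (Pi.single i 1) = Pi.single i 1 := by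
      intro i; ext j; by_cases h : j = i
      · subst h; simp [toReal]
      · simp [toReal, h]
    have h2 : ∀ i : Fin n, toReal (-Pi.single i 1) = -Pi.single i 1 := by
      intro i; rw [← h1]; ext j; simp [toReal]
    simp only [Set.image_empty, Submodule.span_empty, Submodule.mem_bot]
    constructor
    · rintro rfl a -
      simp
    · intro h
      ext i
      have h3 := h (Pi.single i 1) (Finset.mem_union_left _ (by simp))
      have h4 := h (-Pi.single i 1) (Finset.mem_union_right _ (by simp))
      rw [h1, single_dotProduct] at h3
      rw [h2, neg_dotProduct, single_dotProduct] at h4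
      simp only [Pi.zero_apply]
      linarith
  | @insert g U _ _ ih =>
    obtain ⟨A, hA⟩ := ih
    obtain ⟨A', hA'⟩ := exists_elimination A g
    refine ⟨A', fun x => ?_⟩
    rw [← hA', Set.image_insert_eq, Submodule.mem_span_insert]
    constructor
    · rintro ⟨t, z, hz, rfl⟩
      refine ⟨t, t.2, ?_⟩
      have : t • toReal g + z - (t : ℝ) • toReal g = z := by
        rw [NNReal.smul_def]; abel
      rw [this]
      exact (hA z).1 hz
    · rintro ⟨t, ht, h⟩
      lift t to NNReal using ht
      exact ⟨t, _, (hA _).2 h, by rw [NNReal.smul_def]; simp⟩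

/-! ### Tangent cones and polyhedrality of the hull -/

/-- The steps of length at most one, in the sup norm, that lead from `p` to a point of `S`. -/
def unitSteps (S : Set (Fin n → ℤ)) (p : Fin n → ℤ) : Set (Fin n → ℤ) :=
  {u | p + u ∈ S ∧ ∀ i, |u i| ≤ 1}

theorem finite_unit_steps (n : ℕ) : {u : Fin n → ℤ | ∀ i, |u i| ≤ 1}.Finite :=
  (Set.finite_Icc (fun _ : Fin n => (-1 : ℤ)) (fun _ => 1)).subset fun _ hu =>
    ⟨fun i => (abs_le.1 (hu i)).1, fun i => (abs_le.1 (hu i)).2⟩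

/-- The cone of feasible directions of `hull S` at `p`. -/
def tangentCone (S : Set (Fin n → ℤ)) (p : Fin n → ℤ) : Submodule NNReal (Fin n → ℝ) :=
  Submodule.span NNReal (toReal '' unitSteps S p)

/-- Scale `x - p` down until its entries are below 1 in absolute value. The lattice points
representing the shrunken point are then at distance less than 2, hence at most 1, from `p`, so they
are unit steps. -/
theorem IsIntegrallyConvex.sub_mem_tangentCone (hS : IsIntegrallyConvex S) {p : Fin n → ℤ}
    (hp : p ∈ S) {x : Fin n → ℝ} (hx : x ∈ hull S) : x - toReal p ∈ tangentCone S p := by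
  have hconv : Convex ℝ {y : Fin n → ℝ | y - toReal p ∈ tangentCone S p} := by
    intro y hy z hz s t hs ht hst
    lift s to NNReal using hs
    lift t to NNReal using ht
    have : (s : ℝ) • y + (t : ℝ) • z - toReal p = s • (y - toReal p) + t • (z - toReal p) := by
      ext i
      simp only [NNReal.smul_def, Pi.add_apply, Pi.smul_apply, Pi.sub_apply, smul_eq_mul]
      linear_combination (toReal p i) * hst
    rw [Set.mem_ofPred_eq, this]
    exact add_mem (Submodule.smul_mem _ _ hy) (Submodule.smul_mem _ _ hz)
  obtain ⟨R, hR⟩ := exists_mem_box (x - toReal p)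
  have hR := mem_box.1 (hR R le_rfl)
  set ε : ℝ := 1 / (R + 1) with hε
  have hε0 : 0 < ε := by positivity
  have hε1 : ε ≤ 1 := by
    rw [hε, div_le_one (by positivity)]
    linarith [(Nat.cast_nonneg R : (0 : ℝ) ≤ R)]
  have hy : toReal p + ε • (x - toReal p) ∈ hull S :=
    (convex_hull S).add_smul_sub_mem (mem_hull hp) hx ⟨hε0.le, hε1⟩
  have hy' : toReal p + ε • (x - toReal p) ∈ {y : Fin n → ℝ | y - toReal p ∈ tangentCone S p} := by
    refine convexHull_min ?_ hconv (hS.mem_hull_neighborhood hy)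
    rintro _ ⟨w, ⟨hwS, hw⟩, rfl⟩
    refine Submodule.subset_span ⟨w - p, ⟨by simpa using hwS, fun i => ?_⟩, ?_⟩
    · have h1 := abs_lt.1 (hw i)
      have h2 : |ε * (x - toReal p) i| < 1 := by
        rw [abs_mul, abs_of_pos hε0, hε, one_div_mul_eq_div, div_lt_one (by positivity)]
        linarith [hR i]
      have h2 := abs_lt.1 h2
      simp only [Pi.add_apply, Pi.smul_apply, smul_eq_mul, toReal] at h1 h2
      have h3 : w i - p i < 2 := by
        have : ((w i - p i : ℤ) : ℝ) < 2 := by push_cast; linarith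
        exact_mod_cast this
      have h4 : -2 < w i - p i := by
        have : (-2 : ℝ) < ((w i - p i : ℤ) : ℝ) := by push_cast; linarith
        exact_mod_cast this
      rw [Pi.sub_apply, abs_le]
      omega
    · ext i; simp [toReal]
  clear_value ε
  lift ε to NNReal using hε0.le
  have := Submodule.smul_mem _ ε⁻¹ (Set.mem_ofPred_eq ▸ hy')
  rwa [NNReal.smul_def, NNReal.coe_inv, add_sub_cancel_left, smul_smul,
    inv_mul_cancel₀ hε0.ne', one_smul] at this

theorem exists_add_smul_mem_hull {p : Fin n → ℤ} (hp : p ∈ S) {d : Fin n → ℝ}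
    (hd : d ∈ tangentCone S p) :
    ∃ ε : ℝ, 0 < ε ∧ ∀ δ : ℝ, 0 ≤ δ → δ ≤ ε → toReal p + δ • d ∈ hull S := by
  induction hd using Submodule.span_induction with
  | mem x hx =>
    obtain ⟨u, hu, rfl⟩ := hx
    refine ⟨1, one_pos, fun δ h0 h1 => ?_⟩
    have : toReal u = toReal (p + u) - toReal p := by ext i; simp [toReal]
    rw [this]
    exact (convex_hull S).add_smul_sub_mem (mem_hull hp) (mem_hull hu.1) ⟨h0, h1⟩
  | zero => exact ⟨1, one_pos, fun δ _ _ => by simpa using mem_hull hp⟩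
  | add x y _ _ hx hy =>
    obtain ⟨ε, hε, hx⟩ := hx
    obtain ⟨η, hη, hy⟩ := hy
    -- `p + δ(x + y)` is the midpoint of `p + 2δx` and `p + 2δy`.
    refine ⟨min ε η / 2, by positivity, fun δ h0 h1 => ?_⟩
    have h2 : 2 * δ ≤ ε := by linarith [min_le_left ε η]
    have h3 : 2 * δ ≤ η := by linarith [min_le_right ε η]
    have := (convex_hull S) (hx (2 * δ) (by positivity) h2) (hy (2 * δ) (by positivity) h3)
      (a := 1 / 2) (b := 1 / 2) (by norm_num) (by norm_num) (by norm_num)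
    convert this using 1
    ext i
    simp only [Pi.add_apply, Pi.smul_apply, smul_eq_mul]
    ring
  | smul c x _ hx =>
    obtain ⟨ε, hε, hx⟩ := hx
    refine ⟨ε / (c + 1), by positivity, fun δ h0 h1 => ?_⟩
    rw [NNReal.smul_def, smul_smul]
    refine hx _ (mul_nonneg h0 c.2) ?_
    rw [le_div_iff₀ (by positivity)] at h1
    nlinarith

/-- The points from which one can move a little towards `y` inside `hull S` form a convex set
containing `S`, hence all of `hull S`. As `hull S` is closed within boxes, continuous induction
along the segment from `p` reaches `y`. -/
theorem IsIntegrallyConvex.mem_hull_of_forall_tangentCone (hS : IsIntegrallyConvex S)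
    {y : Fin n → ℝ} (hy : ∀ p ∈ S, y - toReal p ∈ tangentCone S p) : y ∈ hull S := by
  have hstep : ∀ x ∈ hull S, ∃ ε : ℝ, 0 < ε ∧ ∀ δ : ℝ, 0 ≤ δ → δ ≤ ε → x + δ • (y - x) ∈ hull S := by
    refine convexHull_min (t := {x | ∃ ε : ℝ, 0 < ε ∧ ∀ δ : ℝ, 0 ≤ δ → δ ≤ ε →
      x + δ • (y - x) ∈ hull S}) ?_ ?_
    · rintro _ ⟨p, hp, rfl⟩
      exact exists_add_smul_mem_hull hp (hy p hp)
    · rintro x₁ ⟨ε, hε, h₁⟩ x₂ ⟨η, hη, h₂⟩ s t hs ht hst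
      refine ⟨min ε η, lt_min hε hη, fun δ h0 hδ => ?_⟩
      have := (convex_hull S) (h₁ δ h0 (hδ.trans (min_le_left _ _)))
        (h₂ δ h0 (hδ.trans (min_le_right _ _))) hs ht hst
      convert this using 1
      ext i
      simp only [Pi.add_apply, Pi.smul_apply, Pi.sub_apply, smul_eq_mul]
      linear_combination (-δ * y i) * hst
  obtain ⟨p, hp⟩ := hS.1
  obtain ⟨R₁, hR₁⟩ := exists_mem_box (toReal p)
  obtain ⟨R₂, hR₂⟩ := exists_mem_box y
  set γ : ℝ → (Fin n → ℝ) := fun t => toReal p + t • (y - toReal p) with hγ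
  have hγc : Continuous γ := by fun_prop
  set R := max R₁ R₂
  have hclosed : IsClosed (γ ⁻¹' hull S ∩ Set.Icc 0 1) := by
    have : γ ⁻¹' hull S ∩ Set.Icc 0 1 = γ ⁻¹' (hull S ∩ box n R) ∩ Set.Icc 0 1 := by
      ext t
      refine ⟨fun h => ⟨⟨h.1, ?_⟩, h.2⟩, fun h => ⟨h.1.1, h.2⟩⟩
      exact (convex_box R).add_smul_sub_mem (hR₁ R (le_max_left _ _)) (hR₂ R (le_max_right _ _)) h.2
    rw [this]
    exact ((hS.isClosed_hull_inter_box R).preimage hγc).inter isClosed_Icc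
  have hsub := hclosed.Icc_subset_of_forall_exists_gt (by simpa [hγ] using mem_hull hp) (by
    rintro t ⟨ht, ht0, ht1⟩ u (hu : t < u)
    obtain ⟨ε, hε, h⟩ := hstep _ ht
    set δ := min ε (u - t)
    have hδ : 0 < δ := lt_min hε (sub_pos.2 hu)
    have hδu : δ ≤ u - t := min_le_right _ _
    refine ⟨t + δ * (1 - t), ?_, by nlinarith, by nlinarith⟩
    have := h δ hδ.le (min_le_left _ _)
    rw [Set.mem_preimage]
    convert this using 1
    ext i
    simp only [hγ, Pi.add_apply, Pi.smul_apply, Pi.sub_apply, smul_eq_mul]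
    ring)
  have := hsub (Set.right_mem_Icc.2 zero_le_one)
  simpa [hγ] using this

/-- The convex hull of an integrally convex set is an integer polyhedron. -/
theorem IsIntegrallyConvex.exists_hull_eq (hS : IsIntegrallyConvex S) :
    ∃ (A : Finset (Fin n → ℤ)) (b : (Fin n → ℤ) → ℤ),
      hull S = {x | ∀ a ∈ A, toReal a ⬝ᵥ x ≤ b a} := by
  choose! A hA using exists_dual_description (n := n)
  have hfin : ∀ p, (unitSteps S p).Finite := fun p =>
    (finite_unit_steps n).subset fun u hu => hu.2
  -- `S` may be infinite, but `unitSteps S p` is always a subset of the finite set {-1, 0, 1}ⁿ.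
  have hfinA : {a | ∃ p ∈ S, a ∈ A (unitSteps S p)}.Finite := by
    refine ((finite_unit_steps n).finite_subsets.biUnion fun U _ => (A U).finite_toSet).subset ?_
    rintro a ⟨p, -, ha⟩
    exact Set.mem_biUnion (fun u (hu : u ∈ unitSteps S p) => hu.2) ha
  have hle : ∀ p ∈ S, ∀ a ∈ A (unitSteps S p), ∀ x ∈ hull S,
      toReal a ⬝ᵥ x ≤ toReal a ⬝ᵥ toReal p := by
    intro p hp a ha x hx
    have := (hA _ (hfin p) _).1 (hS.sub_mem_tangentCone hp hx) a ha
    rwa [dotProduct_sub, sub_nonpos] at this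
  have hex : ∀ a, ∃ p, (∃ q ∈ S, a ∈ A (unitSteps S q)) → p ∈ S ∧ a ∈ A (unitSteps S p) := by
    intro a
    by_cases h : ∃ q ∈ S, a ∈ A (unitSteps S q)
    · exact ⟨h.choose, fun _ => h.choose_spec⟩
    · exact ⟨0, fun h' => absurd h' h⟩
  choose p hp using hex
  -- Every `q` whose tangent cone uses `a` maximizes `a` on `S`, so the choice of `p a` does not
  -- affect the bound.
  refine ⟨hfinA.toFinset, fun a => a ⬝ᵥ p a, Set.Subset.antisymm ?_ ?_⟩
  · intro x hx a ha
    obtain ⟨hpS, hap⟩ := hp a (hfinA.mem_toFinset.1 ha)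
    rw [← toReal_dotProduct]
    exact hle _ hpS a hap x hx
  · intro x hx
    refine hS.mem_hull_of_forall_tangentCone fun q hq => (hA _ (hfin q) _).2 fun a ha => ?_
    have h1 := hx a (hfinA.mem_toFinset.2 ⟨q, hq, ha⟩)
    rw [← toReal_dotProduct] at h1
    have h2 := hle q hq a ha _ (mem_hull (hp a ⟨q, hq, ha⟩).1)
    rw [dotProduct_sub]
    linarith

/-! ### The recession cone and its integrality -/

/-- The solution set of the homogeneous inequalities `a ⬝ᵥ d ≤ 0`, for `a ∈ A`. -/
def polarCone (A : Finset (Fin n → ℤ)) : Set (Fin n → ℝ) := {d | ∀ a ∈ A, toReal a ⬝ᵥ d ≤ 0}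

theorem convex_polarCone (A : Finset (Fin n → ℤ)) : Convex ℝ (polarCone A) := by
  simp only [polarCone, Set.ofPred_forall]
  exact convex_iInter₂ fun a _ => convex_dotProduct_le _ _

theorem isClosed_polarCone (A : Finset (Fin n → ℤ)) : IsClosed (polarCone A) := by
  simp only [polarCone, Set.ofPred_forall]
  refine isClosed_biInter fun a _ => isClosed_le ?_ continuous_const
  unfold dotProduct
  fun_prop

theorem isPolyhedralCone_polarCone (A : Finset (Fin n → ℤ)) : IsPolyhedralCone (polarCone A) := by
  refine ⟨⟨⟨0, fun a _ => by simp⟩, A.card, Matrix.of fun j => toReal (A.equivFin.symm j).1, 0, ?_⟩,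
    fun d hd t ht a ha => ?_⟩
  · ext x
    simp only [polarCone, Set.mem_ofPred_eq, Pi.le_def]
    constructor
    · exact fun h j => h _ (A.equivFin.symm j).2
    · intro h a ha
      simpa [Matrix.mulVec] using h (A.equivFin ⟨a, ha⟩)
  · rw [dotProduct_smul, smul_eq_mul]
    exact mul_nonpos_of_nonneg_of_nonpos ht (hd a ha)

/-- A set of integer vectors on which finitely many integer functionals are bounded above has
finitely many elements that dominate all others. -/
theorem exists_finite_dominating (A : Finset (Fin n → ℤ)) (b : (Fin n → ℤ) → ℤ)
    (hS : ∀ z ∈ S, ∀ a ∈ A, a ⬝ᵥ z ≤ b a) :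
    ∃ F ⊆ S, F.Finite ∧ ∀ z ∈ S, ∃ p ∈ F, ∀ a ∈ A, a ⬝ᵥ z ≤ a ⬝ᵥ p := by
  -- Slack vectors; truncation is harmless on `S`. By Dickson's lemma their minimal values are
  -- finite in number.
  let σ : (Fin n → ℤ) → A → ℕ := fun z a => (b a - a.1 ⬝ᵥ z).toNat
  have hwqo : WellQuasiOrdered fun x y : A → ℕ => x ≤ y :=
    WellQuasiOrdered.pi fun _ => wellQuasiOrdered_le
  have : WellQuasiOrderedLE (A → ℕ) := ⟨hwqo⟩
  let M : Set (A → ℕ) := {m | Minimal (· ∈ σ '' S) m}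
  have hM : M.Finite := (setOfPred_minimal_antichain _).finite_of_wellQuasiOrdered hwqo
  have hMS : ∀ m ∈ M, ∃ p ∈ S, σ p = m := fun m hm => hm.prop
  choose! f hf using hMS
  refine ⟨f '' M, by rintro _ ⟨m, hm, rfl⟩; exact (hf m hm).1, hM.image f, fun z hz => ?_⟩
  obtain ⟨m, hmle, hm⟩ := exists_minimal_le_of_wellFoundedLT (· ∈ σ '' S) (σ z) ⟨z, hz, rfl⟩
  refine ⟨f m, ⟨m, hm, rfl⟩, fun a ha => ?_⟩
  have h1 : σ (f m) ⟨a, ha⟩ ≤ σ z ⟨a, ha⟩ := by rw [(hf m hm).2]; exact hmle _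
  have h2 := hS z hz a ha
  have h3 := hS _ (hf m hm).1 a ha
  simp only [σ] at h1
  omega

/-- A nonempty set of integer vectors on which finitely many integer functionals are bounded above
has a lexicographically maximal element `p`: points of the convex hull on which the functionals
agree with `p` are convex combinations of elements with the same property. -/
theorem exists_lexicographic_maximizer (I : Finset (Fin n → ℤ)) (hne : S.Nonempty)
    (hI : ∀ a ∈ I, ∃ m : ℤ, ∀ z ∈ S, a ⬝ᵥ z ≤ m) :
    ∃ p ∈ S, ∀ T ⊆ S, ∀ x ∈ hull T, (∀ a ∈ I, toReal a ⬝ᵥ x = toReal a ⬝ᵥ toReal p) →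
      x ∈ hull {z ∈ T | ∀ a ∈ I, a ⬝ᵥ z = a ⬝ᵥ p} := by
  classical
  induction I using Finset.induction_on generalizing S with
  | empty =>
    obtain ⟨p, hp⟩ := hne
    exact ⟨p, hp, fun T _ x hx _ => by simpa using hx⟩
  | insert a I _ ih =>
    obtain ⟨m, hm⟩ := hI a (Finset.mem_insert_self _ _)
    obtain ⟨z₀, hz₀⟩ := hne
    obtain ⟨M, ⟨z₁, hz₁, hz₁M⟩, hM⟩ := Int.exists_greatest_of_bdd (P := fun c => ∃ z ∈ S, a ⬝ᵥ z = c)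
      ⟨m, by rintro _ ⟨z, hz, rfl⟩; exact hm z hz⟩ ⟨_, z₀, hz₀, rfl⟩
    -- The functionals need not attain their maxima at a common point, so the remaining ones are
    -- maximized only on the face where `a` is maximal.
    obtain ⟨p, ⟨hpS, hpM⟩, hp⟩ := ih (S := {z ∈ S | a ⬝ᵥ z = M}) ⟨z₁, hz₁, hz₁M⟩
      fun c hc => by
        obtain ⟨m, hm⟩ := hI c (Finset.mem_insert_of_mem hc)
        exact ⟨m, fun z hz => hm z hz.1⟩
    refine ⟨p, hpS, fun T hT x hx hxp => ?_⟩
    have h1 : x ∈ hull {z ∈ T | toReal a ⬝ᵥ toReal z = M} := by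
      refine mem_hull_maximizers (fun z hz => ?_) hx ?_
      · rw [toReal_dotProduct]
        exact_mod_cast hM _ ⟨z, hT hz, rfl⟩
      · rw [hxp a (Finset.mem_insert_self _ _), toReal_dotProduct, hpM]
    simp only [toReal_dotProduct, Int.cast_inj] at h1
    refine hull_mono ?_ (hp {z ∈ T | a ⬝ᵥ z = M} (fun z hz => ⟨hT hz.1, hz.2⟩) x h1
      fun c hc => hxp c (Finset.mem_insert_of_mem hc))
    rintro z ⟨⟨hzT, hzM⟩, hz⟩
    refine ⟨hzT, fun c hc => ?_⟩
    rcases Finset.mem_insert.1 hc with rfl | hc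
    · rw [hzM, hpM]
    · exact hz c hc

theorem finite_integralNeighborhood (x : Fin n → ℝ) : (integralNeighborhood x).Finite := by
  obtain ⟨R, hR⟩ := exists_mem_box x
  exact (finite_integerPoints_box R).subset (integralNeighborhood_subset_box (hR R le_rfl))

/-- The unit cube with lower corner `k`. -/
def unitCube (k : Fin n → ℤ) : Set (Fin n → ℝ) := Set.Icc (toReal k) (toReal k + 1)

theorem exists_mem_unitCube (x : Fin n → ℝ) : ∃ k, x ∈ unitCube k :=
  ⟨fun i => ⌊x i⌋, fun _ => Int.floor_le _, fun _ => (Int.lt_floor_add_one _).le⟩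

theorem integralNeighborhood_subset_unitCube {k : Fin n → ℤ} {x : Fin n → ℝ} (hx : x ∈ unitCube k) :
    integralNeighborhood x ⊆ integerPoints (unitCube k) := by
  intro z hz
  have key : ∀ i, k i ≤ z i ∧ z i ≤ k i + 1 := by
    intro i
    have h1 := hx.1 i
    have h2 := hx.2 i
    have h3 := abs_lt.1 (hz i)
    simp only [toReal, Pi.add_apply, Pi.one_apply] at h1 h2
    constructor
    · have : ((k i - 1 : ℤ) : ℝ) < z i := by push_cast; linarith
      have : k i - 1 < z i := by exact_mod_cast this
      omega
    · have : (z i : ℝ) < ((k i + 2 : ℤ) : ℝ) := by push_cast; linarith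
      have : z i < k i + 2 := by exact_mod_cast this
      omega
  constructor
  · intro i
    simpa [toReal] using (key i).1
  · intro i
    simp only [toReal, Pi.add_apply, Pi.one_apply]
    exact_mod_cast (key i).2

theorem integerPoints_unitCube_subset (k : Fin n → ℤ) :
    integerPoints (unitCube k) ⊆ integralNeighborhood (fun i => (k i : ℝ) + 1 / 2) := by
  intro z hz i
  have h1 := hz.1 i
  have h2 := hz.2 i
  simp only [toReal, Pi.add_apply, Pi.one_apply] at h1 h2
  rw [abs_lt]
  constructor <;> linarith

/-- The vertices of the intersection of the recession cone with a unit cube are integral. -/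
theorem IsIntegrallyConvex.extremePoints_polarCone_subset (hS : IsIntegrallyConvex S)
    {A : Finset (Fin n → ℤ)} {b : (Fin n → ℤ) → ℤ}
    (hAb : hull S = {x | ∀ a ∈ A, toReal a ⬝ᵥ x ≤ b a}) (k : Fin n → ℤ) :
    (polarCone A ∩ unitCube k).extremePoints ℝ ⊆ Set.range toReal := by
  intro v hv
  obtain ⟨hvC, hvk⟩ := hv.1
  have hb : ∀ a ∈ A, ∀ z ∈ S, a ⬝ᵥ z ≤ b a := by
    intro a ha z hz
    have := hAb.subset (mem_hull hz) a ha
    rw [toReal_dotProduct] at this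
    exact_mod_cast this
  -- The functionals tight at `v` take the same values at `p + v` as at `p`, so they are constant on
  -- the lattice points representing `p + v`.
  obtain ⟨p, hp, hlex⟩ := exists_lexicographic_maximizer (A.filter fun a => toReal a ⬝ᵥ v = 0) hS.1
    fun a ha => ⟨b a, hb a (Finset.mem_filter.1 ha).1⟩
  set x := toReal p + v with hx
  have hxS : x ∈ hull S := by
    rw [hAb]
    intro a ha
    have h1 := hAb.subset (mem_hull hp) a ha
    have h2 := hvC a ha
    rw [hx, dotProduct_add]
    linarith
  have hxW := hlex _ Set.inter_subset_left x (hS.mem_hull_neighborhood hxS) fun a ha => by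
    rw [hx, dotProduct_add, (Finset.mem_filter.1 ha).2, add_zero]
  set W := {z ∈ S ∩ integralNeighborhood x |
    ∀ a ∈ A.filter fun a => toReal a ⬝ᵥ v = 0, a ⬝ᵥ z = a ⬝ᵥ p}
  have hWfin : W.Finite := (finite_integralNeighborhood x).subset fun z hz => hz.1.2
  -- Moving from `v` along `w - x` keeps tight inequalities tight, and the strict ones survive for
  -- small `ε`.
  obtain ⟨ε, hε, hε0, hε1⟩ : ∃ ε : ℝ, (∀ w ∈ W, ∀ a ∈ A,
      toReal a ⬝ᵥ v + ε * (toReal a ⬝ᵥ (toReal w - x)) ≤ 0) ∧ 0 < ε ∧ ε ≤ 1 := by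
    have h1 : ∀ᶠ ε : ℝ in nhdsWithin 0 (Set.Ioi 0), ∀ w ∈ W, ∀ a ∈ A,
        toReal a ⬝ᵥ v + ε * (toReal a ⬝ᵥ (toReal w - x)) ≤ 0 := by
      refine (Filter.eventually_all_finite hWfin).2 fun w hw =>
        (Filter.eventually_all_finset A).2 fun a ha => ?_
      rcases (hvC a ha).lt_or_eq with h | h
      · refine Filter.Eventually.filter_mono nhdsWithin_le_nhds ?_
        have hc : Continuous fun ε : ℝ => toReal a ⬝ᵥ v + ε * (toReal a ⬝ᵥ (toReal w - x)) := by
          fun_prop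
        have := hc.tendsto 0
        simp only [zero_mul, add_zero] at this
        filter_upwards [this.eventually (gt_mem_nhds h)] with ε h using h.le
      · refine Filter.Eventually.of_forall fun ε => ?_
        have := hw.2 a (Finset.mem_filter.2 ⟨ha, h⟩)
        rw [hx, dotProduct_sub, dotProduct_add, h, toReal_dotProduct, toReal_dotProduct, this]
        simp
    exact (h1.and (Ioc_mem_nhdsGT one_pos)).exists
  set h : (Fin n → ℝ) → (Fin n → ℝ) := fun y => v + ε • (y - x) with hh
  have hv1 : v ∈ convexHull ℝ (h '' (toReal '' W)) := by
    have hsub : hull W ⊆ {y | h y ∈ convexHull ℝ (h '' (toReal '' W))} := by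
      refine convexHull_min (fun y hy => subset_convexHull ℝ _ (Set.mem_image_of_mem h hy)) ?_
      intro y hy z hz s t hs ht hst
      have := (convex_convexHull ℝ _) hy hz hs ht hst
      rw [Set.mem_ofPred_eq]
      convert this using 1
      ext i
      simp only [hh, Pi.add_apply, Pi.smul_apply, Pi.sub_apply, smul_eq_mul]
      linear_combination (-v i + ε * x i) * hst
    simpa [hh] using hsub hxW
  have hsub : convexHull ℝ (h '' (toReal '' W)) ⊆ polarCone A ∩ unitCube k := by
    refine convexHull_min ?_ ((convex_polarCone A).inter (convex_Icc _ _))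
    rintro _ ⟨_, ⟨w, hw, rfl⟩, rfl⟩
    refine ⟨fun a ha => ?_, ?_⟩
    · change toReal a ⬝ᵥ (v + ε • (toReal w - x)) ≤ 0
      rw [dotProduct_add, dotProduct_smul, smul_eq_mul]
      exact hε w hw a ha
    · have hwN : w - p ∈ integralNeighborhood v := by
        intro i
        have := hw.1.2 i
        simp only [hx, Pi.add_apply, toReal] at this
        rw [Pi.sub_apply]
        push_cast
        convert this using 2
        ring
      have hmem := (convex_Icc _ _ : Convex ℝ (unitCube k)).add_smul_sub_mem hvk
        (integralNeighborhood_subset_unitCube hvk hwN) ⟨hε0.le, hε1⟩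
      have heq : h (toReal w) = v + ε • (toReal (w - p) - v) := by
        ext i
        simp only [hh, hx, Pi.add_apply, Pi.smul_apply, Pi.sub_apply, smul_eq_mul, toReal]
        push_cast
        ring
      rwa [heq]
  -- The points `v + ε(w - x)` average to `v`, so extremality makes one of them equal `v`; then `v =
  -- w - p`.
  obtain ⟨_, ⟨w, hw, rfl⟩, hwv⟩ := extremePoints_convexHull_subset
    (inter_extremePoints_subset_extremePoints_of_subset hsub ⟨hv1, hv⟩)
  refine ⟨w - p, ?_⟩
  have h0 : toReal w - x = 0 := by
    have : ε • (toReal w - x) = 0 := by simpa [hh] using hwv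
    exact (smul_eq_zero.1 this).resolve_left hε0.ne'
  ext i
  have := congrFun h0 i
  simp only [hx, toReal, Pi.sub_apply, Pi.add_apply, Pi.zero_apply] at this ⊢
  push_cast
  linarith

/-- By Krein–Milman, the part of the cone in a unit cube is the closed hull of its vertices. They
are integral and lie in the neighborhood of the cube's center, so their hull is local. -/
theorem IsIntegrallyConvex.isIntegrallyConvex_polarCone (hS : IsIntegrallyConvex S)
    {A : Finset (Fin n → ℤ)} {b : (Fin n → ℤ) → ℤ}
    (hAb : hull S = {x | ∀ a ∈ A, toReal a ⬝ᵥ x ≤ b a}) :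
    IsIntegrallyConvex (integerPoints (polarCone A)) := by
  refine isIntegrallyConvex_integerPoints (convex_polarCone A) ⟨0, fun a _ => ?_⟩ fun x hx => ?_
  · rw [toReal_dotProduct]
    simp
  obtain ⟨k, hk⟩ := exists_mem_unitCube x
  refine ⟨fun i => (k i : ℝ) + 1 / 2, ?_⟩
  set N := integralNeighborhood fun i => (k i : ℝ) + 1 / 2
  have hclosed : IsClosed (hull (integerPoints (polarCone A) ∩ N)) :=
    (((finite_integralNeighborhood _).inter_of_right _).image toReal).isClosed_convexHull ℝ
  have hKM := closure_convexHull_extremePoints (s := polarCone A ∩ unitCube k)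
    (isCompact_Icc.inter_left (isClosed_polarCone A))
    ((convex_polarCone A).inter (convex_Icc _ _))
  refine closure_minimal (convexHull_mono ?_) hclosed (hKM.symm.subset ⟨hx, hk⟩)
  intro v hv
  obtain ⟨u, rfl⟩ := hS.extremePoints_polarCone_subset hAb k hv
  exact ⟨u, ⟨hv.1.1, integerPoints_unitCube_subset k hv.1.2⟩, rfl⟩

/-! ### The decomposition -/

theorem IsIntegrallyConvex.exists_hull_eq_add (hS : IsIntegrallyConvex S)
    {A : Finset (Fin n → ℤ)} {b : (Fin n → ℤ) → ℤ}
    (hAb : hull S = {x | ∀ a ∈ A, toReal a ⬝ᵥ x ≤ b a}) :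
    ∃ R, (hull S ∩ box n R).Nonempty ∧ hull S = hull S ∩ box n R + polarCone A := by
  obtain ⟨F, hFS, hF, hdom⟩ := exists_finite_dominating (S := S) A b fun z hz a ha => by
    have := hAb.subset (mem_hull hz) a ha
    rw [toReal_dotProduct] at this
    exact_mod_cast this
  choose r hr using fun p : Fin n → ℤ => exists_mem_box (toReal p)
  -- The box only has to contain the dominating points: each `z ∈ S` is some `p ∈ F` plus a
  -- recession direction.
  obtain ⟨R, hR⟩ := (hF.image r).bddAbove
  have hFR : ∀ p ∈ F, toReal p ∈ hull S ∩ box n R := fun p hp =>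
    ⟨mem_hull (hFS hp), hr p R (hR (Set.mem_image_of_mem r hp))⟩
  refine ⟨R, ?_, Set.Subset.antisymm ?_ ?_⟩
  · obtain ⟨z, hz⟩ := hS.1
    obtain ⟨p, hp, -⟩ := hdom z hz
    exact ⟨_, hFR p hp⟩
  · refine convexHull_min ?_ (((convex_hull S).inter (convex_box R)).add (convex_polarCone A))
    rintro _ ⟨z, hz, rfl⟩
    obtain ⟨p, hp, hpz⟩ := hdom z hz
    refine ⟨toReal p, hFR p hp, toReal z - toReal p, fun a ha => ?_, by simp⟩
    rw [dotProduct_sub, toReal_dotProduct, toReal_dotProduct, sub_nonpos]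
    exact_mod_cast hpz a ha
  · rintro _ ⟨q, hq, d, hd, rfl⟩
    have hq := hq.1
    rw [hAb] at hq ⊢
    intro a ha
    have h1 := hq a ha
    have h2 := hd a ha
    rw [dotProduct_add]
    linarith

theorem IsIntegrallyConvex.isPolytope_inter_box (hS : IsIntegrallyConvex S) (R : ℕ) :
    IsPolytope (hull S ∩ box n R) :=
  ⟨_, ((finite_integerPoints_box R).inter_of_right S).image toReal, hS.hull_inter_box R⟩

end IntConvex

theorem mainTheorem8 (n : ℕ) (S : Set (Fin n → ℤ)) (hS : IntConvex.IsIntegrallyConvex S) :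
    ∃ Q C : Set (Fin n → ℝ),
      IntConvex.IsPolytope Q ∧
      IntConvex.IsPolyhedralCone C ∧
      IntConvex.hull S = Q + C ∧
      IntConvex.IsIntegrallyConvex (IntConvex.integerPoints Q) ∧
      IntConvex.IsIntegrallyConvex (IntConvex.integerPoints C) := by
  obtain ⟨A, b, hAb⟩ := hS.exists_hull_eq
  obtain ⟨R, hne, hR⟩ := hS.exists_hull_eq_add hAb
  exact ⟨IntConvex.hull S ∩ IntConvex.box n R, IntConvex.polarCone A, hS.isPolytope_inter_box R,
    IntConvex.isPolyhedralCone_polarCone A, hR, hS.isIntegrallyConvex_inter_box hne,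
    hS.isIntegrallyConvex_polarCone hAb⟩
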